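/- All graphs are finite and simple. Call a graph *Ramsey for cyclicity* if each of its $2$-edge-colourings has a monochromatic cycle, and *minimal* Ramsey for cyclicity if moreover no proper subgraph of it is Ramsey for cyclicity. Let $K_5-e$ be $K_5$ with one edge deleted, let $K_4\vee K_4$ be the graph obtained from two copies of $K_4$ by identifying an edge of one with an edge of the other, and write $H\prec G$ if $H$ is a minor of $G$ that is not isomorphic to $G$. For an edge $e$ of $G$ let $G/e$ be the simple graph obtained by contracting $e$ (deleting loops and merging parallel edges). A *reduction step* from $G$ to $H$ consists in choosing an edge $e$ of $G$ that belongs to at most one triangle of $G$ and choosing a minimal Ramsey graph for cyclicity $H\subseteq G/e$. Graphs are considered up to isomorphism. **Theorem.** Let $G$ be a minimal Ramsey graph for cyclicity. 1. There are $n\ge 0$ and minimal Ramsey graphs for cyclicity $G_0,\dots,G_n$ with $$\{K_5-e,\;K_4\vee K_4\}\ni G_0\prec G_1\prec\dots\prec G_n=G .$$ 2. In fact one can take $G_{k-1}$ to be the result of a reduction step from $G_k$, for every $1\le k\le n$, with all choices made arbitrarily. That is: - for every edge $e$ of $G$ that belongs to at most one triangle of $G$, the graph $G/e$ is Ramsey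 for cyclicity, it has a subgraph that is a minimal Ramsey graph for cyclicity, and every such subgraph $H$ satisfies $H\prec G$; - every finite sequence of reduction steps that starts at $G$ can be continued by further reduction steps (possibly none) until it ends in $K_5-e$ or $K_4\vee K_4$, and it then forms, read backwards, a chain as in 1; - there is no infinite sequence of reduction steps that starts at $G$. -/

import Mathlib

universe u

namespace CyclicRamsey

/-- Every `2`-edge-colouring of `G` has a monochromatic cycle. -/
def IsRamsey {V : Type*} (G : SimpleGraph V) : Prop :=
  ∀ c : G.EdgeLabeling (Fin 2), ∃ i : Fin 2, ∃ (v : V) (p : (c.labelGraph i).Walk v v), p.IsCycle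

/-- `G` is Ramsey for cyclicity and no proper subgraph of `G` is. A subgraph has its own vertex
set, so it is also proper when it only misses vertices. -/
def IsMinimalRamsey {V : Type*} (G : SimpleGraph V) : Prop :=
  IsRamsey G ∧ ∀ H : G.Subgraph, H ≠ ⊤ → ¬ IsRamsey H.coe

/-- The two ends of `e` are identified, all other vertices are left alone. -/
def contractSetoid {V : Type*} (e : Sym2 V) : Setoid V where
  r x y := x = y ∨ (x ∈ e ∧ y ∈ e)
  iseqv := by
    refine ⟨fun x => Or.inl rfl, ?_, ?_⟩
    · rintro x y (h | ⟨h1, h2⟩)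
      · exact Or.inl h.symm
      · exact Or.inr ⟨h2, h1⟩
    · rintro x y z (rfl | ⟨h1, h2⟩) (rfl | ⟨h3, h4⟩)
      · exact Or.inl rfl
      · exact Or.inr ⟨h3, h4⟩
      · exact Or.inr ⟨h1, h2⟩
      · exact Or.inr ⟨h1, h4⟩

/-- The simple graph `G / e`: loops are deleted and parallel edges are merged. -/
def contract {V : Type*} (G : SimpleGraph V) (e : Sym2 V) :
    SimpleGraph (Quotient (contractSetoid e)) :=
  G.map (Quotient.mk (contractSetoid e))

/-- `e` is an edge of `G` that belongs to at most one triangle of `G`. -/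
def IsContractible {V : Type*} (G : SimpleGraph V) (e : Sym2 V) : Prop :=
  e ∈ G.edgeSet ∧ {t : Finset V | t ∈ G.cliqueSet 3 ∧ ∀ x ∈ e, x ∈ t}.encard ≤ 1

/-- `G` is a minor of `H`, by means of branch sets. (`Connected` includes non-emptiness.) -/
def IsMinor {V W : Type*} (G : SimpleGraph V) (H : SimpleGraph W) : Prop :=
  ∃ B : V → Set W, (∀ v, (H.induce (B v)).Connected) ∧
    (∀ v w, v ≠ w → Disjoint (B v) (B w)) ∧
    ∀ v w, G.Adj v w → ∃ x ∈ B v, ∃ y ∈ B w, H.Adj x y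

/-- `G` is a minor of `H` that is not isomorphic to `H`. -/
def IsProperMinor {V W : Type*} (G : SimpleGraph V) (H : SimpleGraph W) : Prop :=
  IsMinor G H ∧ IsEmpty (G ≃g H)

/-- `K₅ - e`. -/
def K5e : SimpleGraph (Fin 5) := (⊤ : SimpleGraph (Fin 5)).deleteEdges {s(3, 4)}

/-- `K₄ ∨ K₄`: copies of `K₄` on `{0, 1, 2, 3}` and `{0, 1, 4, 5}` sharing the edge `01`. -/
def K4vK4 : SimpleGraph (Fin 6) where
  Adj i j := i ≠ j ∧ ((i ∈ ({0, 1, 2, 3} : Finset (Fin 6)) ∧ j ∈ ({0, 1, 2, 3} : Finset (Fin 6))) ∨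
    (i ∈ ({0, 1, 4, 5} : Finset (Fin 6)) ∧ j ∈ ({0, 1, 4, 5} : Finset (Fin 6))))
  symm := ⟨fun _ _ ⟨hne, h⟩ => ⟨hne.symm, h.imp And.symm And.symm⟩⟩
  loopless := ⟨fun _ h => h.1 rfl⟩

/-- Up to isomorphism, `G` is one of the two base graphs. -/
def IsBase {V : Type*} (G : SimpleGraph V) : Prop :=
  Nonempty (G ≃g K5e) ∨ Nonempty (G ≃g K4vK4)

/-- A finite graph together with its vertex set. -/
structure FinGraph where
  V : Type u
  [fin : Finite V]
  graph : SimpleGraph V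

/-- One reduction step: up to isomorphism, `H` is a minimal Ramsey subgraph of `G / e` for an edge
`e` that belongs to at most one triangle of `G`. -/
def IsReduction (H G : FinGraph.{u}) : Prop :=
  ∃ e : Sym2 G.V, IsContractible G.graph e ∧
    ∃ K : (contract G.graph e).Subgraph, IsMinimalRamsey K.coe ∧ Nonempty (H.graph ≃g K.coe)

/-- The graphs `S 0, …, S n` form a chain `S 0 ≺ S 1 ≺ … ≺ S n = G` of minimal Ramsey graphs that
starts at one of the two base graphs. -/
def IsMinorChain (n : ℕ) (S : ℕ → FinGraph.{u}) (G : FinGraph.{u}) : Prop :=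
  IsBase (S 0).graph ∧ S n = G ∧ (∀ k ≤ n, IsMinimalRamsey (S k).graph) ∧
    ∀ k < n, IsProperMinor (S k).graph (S (k + 1)).graph

end CyclicRamsey

/-! A graph is Ramsey for cyclicity iff it is not covered by two forests (`isRamsey_iff`), so the
theorem is about forest covers.

Contraction. Let `uv` be an edge in at most one triangle, and let two forests cover `G/uv`; pull
them back to `G`. If `u` and `v` have no common neighbour, both pullbacks are forests, and the first
stays one when `uv` is added. If `x` is their only common neighbour, `xu` and `xv` lie in the
pullback of a common forest. Without `xv` that pullback is a forest separating `u` from `v`, hence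
`x` from `v`, so `xv` can be put back, while `uv` goes to the other forest. Either way `G` is
covered (`isTwoForest_of_identify`). So contracting `uv` keeps a Ramsey graph Ramsey, and the
minimal Ramsey subgraphs of `G/uv` are minors of `G` with fewer vertices.

End of the process. Let every edge of a minimal Ramsey graph `G` be in two triangles
(`IsMinimalRamsey.isBase`). Deleting an edge leaves two forests, so `G` has at most `2n - 1` edges
and average degree below `4`. Two copies of `K₄` sharing at least two vertices contain a base graph,
which is then all of `G`. If there are no such copies, discharging yields average degree at least
`4` (`four_mul_card_le_sum_degree`), a contradiction. -/

namespace CyclicRamsey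

open SimpleGraph

/-! ### Forests and covers by two forests -/

/-- `G` is covered by two forests. -/
def IsTwoForest {V : Type*} (G : SimpleGraph V) : Prop :=
  ∃ F₁ F₂ : SimpleGraph V, F₁.IsAcyclic ∧ F₂.IsAcyclic ∧ G ≤ F₁ ⊔ F₂

/-- The colour classes are the forests; an edge in both forests may take either colour. -/
theorem isRamsey_iff {V : Type*} {G : SimpleGraph V} : IsRamsey G ↔ ¬ IsTwoForest G := by
  classical
  constructor
  · rintro h ⟨F₁, F₂, h₁, h₂, hG⟩
    obtain ⟨i, v, p, hp⟩ := h fun e => if e.1 ∈ F₁.edgeSet then 0 else 1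
    fin_cases i
    · refine h₁.anti ?_ p hp
      intro x y hxy
      obtain ⟨_, h⟩ := (EdgeLabeling.labelGraph_adj _ _).1 hxy
      by_contra hn
      simp [hn] at h
    · refine h₂.anti ?_ p hp
      intro x y hxy
      obtain ⟨ha, h⟩ := (EdgeLabeling.labelGraph_adj _ _).1 hxy
      by_contra hn
      rcases hG ha with h' | h'
      · simp [h'] at h
      · exact hn h'
  · intro h c
    by_contra! hc
    refine h ⟨c.labelGraph 0, c.labelGraph 1, fun v p => hc 0 v p, fun v p => hc 1 v p, ?_⟩
    intro x y hxy
    rcases (show c ⟨s(x, y), hxy⟩ = 0 ∨ c ⟨s(x, y), hxy⟩ = 1 by omega) with h0 | h0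
    · exact Or.inl ((EdgeLabeling.labelGraph_adj _ _).2 ⟨hxy, h0⟩)
    · exact Or.inr ((EdgeLabeling.labelGraph_adj _ _).2 ⟨hxy, h0⟩)

/-- A forest is contained in a spanning tree of the complete graph. -/
theorem exists_isTree_ge {V : Type*} [Finite V] [Nonempty V] {F : SimpleGraph V}
    (hF : F.IsAcyclic) : ∃ T : SimpleGraph V, F ≤ T ∧ T.IsTree := by
  obtain ⟨T, h₁, h₂, h₃⟩ :=
    (connected_top (V := V)).exists_isTree_le_of_le_of_isAcyclic (le_top : F ≤ ⊤) hF
  exact ⟨T, by assumption, by assumption⟩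

theorem IsAcyclic.ncard_edgeSet_lt {V : Type*} [Finite V] [Nonempty V] {F : SimpleGraph V}
    (hF : F.IsAcyclic) : F.edgeSet.ncard < Nat.card V := by
  classical
  have := Fintype.ofFinite V
  obtain ⟨T, hle, hT⟩ := exists_isTree_ge hF
  have h := hT.card_edgeFinset
  have h' : F.edgeSet.ncard ≤ T.edgeSet.ncard :=
    Set.ncard_le_ncard (edgeSet_mono hle) (Set.toFinite _)
  rw [← coe_edgeFinset T, Set.ncard_coe_finset] at h'
  rw [Nat.card_eq_fintype_card]
  omega

theorem IsTwoForest.ncard_edgeSet_add_two_le {V : Type*} [Finite V] [Nonempty V]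
    {G : SimpleGraph V} (hG : IsTwoForest G) : G.edgeSet.ncard + 2 ≤ 2 * Nat.card V := by
  obtain ⟨F₁, F₂, h₁, h₂, h⟩ := hG
  have h₃ := IsAcyclic.ncard_edgeSet_lt h₁
  have h₄ := IsAcyclic.ncard_edgeSet_lt h₂
  have h₅ : G.edgeSet.ncard ≤ (F₁.edgeSet ∪ F₂.edgeSet).ncard := by
    rw [← edgeSet_sup]
    exact Set.ncard_le_ncard (edgeSet_mono h) (Set.toFinite _)
  have h₆ := Set.ncard_union_le F₁.edgeSet F₂.edgeSet
  omega

/-- The forest induced on `X` extends to a tree on `X`, which has a leaf; conversely, on the support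
of a cycle each vertex has two neighbours. This lets forests be handled without walks. -/
theorem isAcyclic_iff_exists_leaf {V : Type*} {F : SimpleGraph V} :
    F.IsAcyclic ↔ ∀ X : Finset V, X.Nonempty →
      ∃ x ∈ X, ∀ y ∈ X, ∀ z ∈ X, F.Adj x y → F.Adj x z → y = z := by
  classical
  constructor
  · intro hF X hX
    have : Nonempty X := hX.to_subtype
    obtain ⟨T, hle, hT⟩ := exists_isTree_ge (hF.induce (X : Set V))
    rcases subsingleton_or_nontrivial X with hs | hs
    · obtain ⟨x, hx⟩ := hX
      refine ⟨x, hx, fun y hy z hz _ _ => ?_⟩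
      exact congrArg Subtype.val (Subsingleton.elim (⟨y, hy⟩ : X) ⟨z, hz⟩)
    · obtain ⟨x, hx⟩ := hT.exists_vert_degree_one_of_nontrivial
      rw [degree_eq_one_iff_existsUnique_adj] at hx
      refine ⟨x.1, x.2, fun y hy z hz hxy hxz => ?_⟩
      have := hx.unique (y₁ := ⟨y, hy⟩) (y₂ := ⟨z, hz⟩) (hle hxy) (hle hxz)
      exact congrArg Subtype.val this
  · intro h v p hp
    obtain ⟨x, hx, hl⟩ := h p.support.toFinset ⟨v, by simp⟩
    have h2 := hp.ncard_neighborSet_toSubgraph_eq_two (by simpa using hx)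
    obtain ⟨y, z, hyz, hset⟩ := Set.ncard_eq_two.1 h2
    have hy : p.toSubgraph.Adj x y := by
      rw [← Subgraph.mem_neighborSet, hset]; simp
    have hz : p.toSubgraph.Adj x z := by
      rw [← Subgraph.mem_neighborSet, hset]; simp
    refine hyz (hl y ?_ z ?_ hy.adj_sub hz.adj_sub)
    · simpa using hy.snd_mem
    · simpa using hz.snd_mem

theorem isAcyclic_map {V W : Type*} {F : SimpleGraph V} (hF : F.IsAcyclic) (f : V ↪ W) :
    (F.map f).IsAcyclic := by
  classical
  rw [isAcyclic_iff_exists_leaf] at hF ⊢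
  intro X hX
  by_cases hr : ∃ x ∈ X, x ∉ Set.range f
  · obtain ⟨x, hx, hxr⟩ := hr
    refine ⟨x, hx, fun y _ z _ hxy _ => ?_⟩
    obtain ⟨a, b, _, rfl, _⟩ := (map_adj _ _ _ _).1 hxy
    exact (hxr ⟨a, rfl⟩).elim
  · push Not at hr
    obtain ⟨x₀, hx₀⟩ := hX
    obtain ⟨a₀, rfl⟩ := hr x₀ hx₀
    obtain ⟨a, ha, hl⟩ := hF (X.preimage f f.injective.injOn) ⟨a₀, by simpa using hx₀⟩
    refine ⟨f a, by simpa using ha, fun y hy z hz hxy hxz => ?_⟩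
    obtain ⟨b, rfl⟩ := hr y hy
    obtain ⟨c, rfl⟩ := hr z hz
    rw [map_adj_apply] at hxy hxz
    rw [hl b (by simpa using hy) c (by simpa using hz) hxy hxz]

theorem isAcyclic_sup_edge_of_isolated {V : Type*} {F : SimpleGraph V} (hF : F.IsAcyclic)
    {x w : V} (hw : ∀ y, ¬ F.Adj w y) : (F ⊔ edge x w).IsAcyclic := by
  rw [isAcyclic_sup_fromEdgeSet_iff]
  refine ⟨hF, fun ⟨p⟩ => ?_⟩
  cases p.reverse with
  | nil => exact Or.inl rfl
  | cons h _ => exact (hw _ h).elim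

/-! ### Lifting forests through the identification of two vertices -/

/-- A graph is a forest if identifying two vertices without common neighbour makes it one. -/
theorem isAcyclic_of_identify {V W : Type*} {q : V → W} {u v : V}
    (hq : ∀ x y, q x = q y → x = y ∨ (x = u ∧ y = v) ∨ (x = v ∧ y = u))
    {F : SimpleGraph W} (hF : F.IsAcyclic) {H : SimpleGraph V}
    (hH : ∀ x y, H.Adj x y → q x = q y ∨ F.Adj (q x) (q y))
    (hc : ∀ x, H.Adj x u → ¬ H.Adj x v) : H.IsAcyclic := by
  classical
  rw [isAcyclic_iff_exists_leaf] at hF ⊢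
  intro X hX
  obtain ⟨w, hw, hl⟩ := hF (X.image q) (hX.image q)
  obtain ⟨x, hx, rfl⟩ := Finset.mem_image.1 hw
  -- Since `q x` is a leaf, all edges from the fibre of `x` to other fibres end in one and the same
  -- fibre.
  have key : ∀ a ∈ X, q a = q x → ∀ b ∈ X, q b = q x → ∀ y ∈ X, ∀ z ∈ X, H.Adj a y → H.Adj b z →
      q a ≠ q y → q b ≠ q z → q y = q z := by
    intro a ha hax b hb hbx y hy z hz hay hbz h1 h2
    refine hl (q y) (Finset.mem_image_of_mem _ hy) (q z) (Finset.mem_image_of_mem _ hz) ?_ ?_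
    · rw [← hax]; exact (hH _ _ hay).resolve_left h1
    · rw [← hbx]; exact (hH _ _ hbz).resolve_left h2
  by_contra! hcon
  -- A fibre has at most two elements, so one of two neighbours of `a` lies outside its fibre.
  have two : ∀ a ∈ X, q a = q x → ∃ y ∈ X, H.Adj a y ∧ q a ≠ q y := by
    intro a ha hax
    obtain ⟨y, hy, z, hz, hay, haz, hyz⟩ := hcon a ha
    by_cases h1 : q a = q y
    · refine ⟨z, hz, haz, fun h2 => ?_⟩
      have := hay.ne; have := haz.ne
      grind
    · exact ⟨y, hy, hay, h1⟩
  obtain ⟨y, hy, z, hz, hxy, hxz, hyz⟩ := hcon x hx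
  have hxy' := hxy.ne
  have hxz' := hxz.ne
  -- If `x` has a neighbour in its own fibre, that fibre is `{u, v}`; the outer neighbours of `u`
  -- and `v` share a fibre other than `{u, v}`, hence coincide. Otherwise the two neighbours of `x`
  -- share a fibre, so they are `u` and `v`. Both times `u` and `v` get a common neighbour.
  by_cases h1 : q x = q y
  · have h2 : q x ≠ q z := by grind
    obtain ⟨t, ht, hyt, hqt⟩ := two y hy h1.symm
    have h3 := key x hx rfl y hy h1.symm z hz t ht hxz hyt h2 hqt
    rcases hq _ _ h1 with h | ⟨rfl, rfl⟩ | ⟨rfl, rfl⟩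
    · exact hxy' h
    all_goals
      rcases hq _ _ h3 with rfl | ⟨rfl, rfl⟩ | ⟨rfl, rfl⟩
      · first
          | exact hc _ hxz.symm hyt.symm
          | exact hc _ hyt.symm hxz.symm
      all_goals simp_all
  · by_cases h2 : q x = q z
    · obtain ⟨t, ht, hzt, hqt⟩ := two z hz h2.symm
      have h3 := key x hx rfl z hz h2.symm y hy t ht hxy hzt h1 hqt
      rcases hq _ _ h2 with h | ⟨rfl, rfl⟩ | ⟨rfl, rfl⟩
      · exact hxz' h
      all_goals
        rcases hq _ _ h3 with rfl | ⟨rfl, rfl⟩ | ⟨rfl, rfl⟩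
        · first
            | exact hc _ hxy.symm hzt.symm
            | exact hc _ hzt.symm hxy.symm
        all_goals simp_all
    · have h3 := key x hx rfl x hx rfl y hy z hz hxy hxz h1 h2
      rcases hq _ _ h3 with h | ⟨rfl, rfl⟩ | ⟨rfl, rfl⟩
      · exact hyz h
      · exact hc _ hxy hxz
      · exact hc _ hxz hxy

/-- The case of one triangle `uvx`, whose edges `xu` and `xv` both map into `F₁`. The covering
forests are `H₀ ⊔ edge x v` and `H₂ ⊔ edge u v`. Adding `uv` to `H₀` only serves to show that `H₀`
does not connect `u` and `v`. -/
theorem isTwoForest_of_identify_aux {V W : Type*} {q : V → W} {G : SimpleGraph V} {u v : V}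
    (huv : G.Adj u v) (hquv : q u = q v)
    (hq : ∀ x y, q x = q y → x = y ∨ (x = u ∧ y = v) ∨ (x = v ∧ y = u))
    (hc : ∀ x y, G.Adj x u → G.Adj x v → G.Adj y u → G.Adj y v → x = y)
    {F₁ F₂ : SimpleGraph W} (h₁ : F₁.IsAcyclic) (h₂ : F₂.IsAcyclic)
    (hG : ∀ x y, G.Adj x y → q x ≠ q y → F₁.Adj (q x) (q y) ∨ F₂.Adj (q x) (q y))
    {x : V} (hxu : G.Adj x u) (hxv : G.Adj x v) (hF : F₁.Adj (q x) (q u)) : IsTwoForest G := by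
  have huv' := huv.ne
  have hxu' := hxu.ne
  have hxv' := hxv.ne
  set H₁ : SimpleGraph V := G ⊓ F₁.comap q with hH₁
  have H₁_adj : ∀ a b, H₁.Adj a b ↔ G.Adj a b ∧ F₁.Adj (q a) (q b) := fun _ _ => Iff.rfl
  -- Removing `H₁` keeps `xu` and `xv` out of `H₂`, even if `F₂` contains their image too.
  set H₂ : SimpleGraph V := (G ⊓ F₂.comap q) \ H₁ with hH₂
  have H₂_adj : ∀ a b, H₂.Adj a b ↔ (G.Adj a b ∧ F₂.Adj (q a) (q b)) ∧ ¬ H₁.Adj a b :=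
    fun _ _ => Iff.rfl
  have hne : ¬ H₁.Adj u v := fun h => by
    have := ((H₁_adj _ _).1 h).2
    rw [hquv] at this
    exact this.ne rfl
  have hxuH : H₁.Adj x u := ⟨hxu, hF⟩
  have hxvH : H₁.Adj x v := ⟨hxv, by rw [comap_adj, ← hquv]; exact hF⟩
  set H₀ : SimpleGraph V := H₁ \ edge x v with hH₀
  have H₀_adj : ∀ a b, H₀.Adj a b ↔ H₁.Adj a b ∧ ¬ (edge x v).Adj a b := fun _ _ => Iff.rfl
  have hA : (H₀ ⊔ edge u v).IsAcyclic := by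
    refine isAcyclic_of_identify hq h₁ ?_ ?_
    · intro a b hab
      rw [sup_adj, H₀_adj, H₁_adj, edge_adj] at hab
      grind
    · intro a ha hb
      rw [sup_adj, H₀_adj, H₁_adj, edge_adj, edge_adj] at ha hb
      have := hc a x
      grind [G.loopless.irrefl]
  have hB : (H₂ ⊔ edge u v).IsAcyclic := by
    refine isAcyclic_of_identify hq h₂ ?_ ?_
    · intro a b hab
      rw [sup_adj, H₂_adj, edge_adj] at hab
      grind
    · intro a ha hb
      rw [sup_adj, H₂_adj, edge_adj] at ha hb
      have := hc a x
      grind [G.loopless.irrefl]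
  rw [isAcyclic_sup_fromEdgeSet_iff] at hA
  have hC : (H₀ ⊔ edge x v).IsAcyclic := by
    refine hA.1.sup_edge_of_not_reachable fun h => ?_
    have hux : H₀.Adj u x := by
      rw [H₀_adj, edge_adj]
      exact ⟨hxuH.symm, by grind⟩
    rcases hA.2 (hux.reachable.trans h) with h | h
    · exact huv' h
    · exact hne h.1
  refine ⟨_, _, hC, hB, ?_⟩
  intro a b hab
  rw [sup_adj, sup_adj, sup_adj, H₀_adj, H₂_adj, H₁_adj, edge_adj, edge_adj]
  have := hG a b hab
  have := hq a b
  have := hab.ne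
  grind

theorem isTwoForest_of_identify {V W : Type*} {q : V → W} {G : SimpleGraph V} {u v : V}
    (huv : G.Adj u v) (hquv : q u = q v)
    (hq : ∀ x y, q x = q y → x = y ∨ (x = u ∧ y = v) ∨ (x = v ∧ y = u))
    (hc : ∀ x y, G.Adj x u → G.Adj x v → G.Adj y u → G.Adj y v → x = y)
    (hG : IsTwoForest (G.map q)) : IsTwoForest G := by
  obtain ⟨F₁, F₂, h₁, h₂, hF⟩ := hG
  have hF' : ∀ x y, G.Adj x y → q x ≠ q y → F₁.Adj (q x) (q y) ∨ F₂.Adj (q x) (q y) :=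
    fun x y hxy hne => hF (map_adj_apply' hxy hne)
  by_cases hx : ∃ x, G.Adj x u ∧ G.Adj x v
  · obtain ⟨x, hxu, hxv⟩ := hx
    have hne : q x ≠ q u := by
      intro h
      have := hxu.ne; have := hxv.ne
      grind
    rcases hF' x u hxu hne with h | h
    · exact isTwoForest_of_identify_aux huv hquv hq hc h₁ h₂ hF' hxu hxv h
    · exact isTwoForest_of_identify_aux huv hquv hq hc h₂ h₁
        (fun a b hab hne => (hF' a b hab hne).symm) hxu hxv h
  · push Not at hx
    refine ⟨G ⊓ (F₁.comap q ⊔ edge u v), G ⊓ F₂.comap q,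
      isAcyclic_of_identify hq h₁ ?_ fun a ha hb => hx a ha.1 hb.1,
      isAcyclic_of_identify hq h₂ (fun a b hab => Or.inr hab.2) fun a ha hb => hx a ha.1 hb.1, ?_⟩
    · rintro a b ⟨-, hab | hab⟩
      · exact Or.inr hab
      · rw [edge_adj] at hab
        grind
    · intro a b hab
      have := hF' a b hab
      have := hq a b
      have := hab.ne
      simp only [sup_adj, inf_adj, comap_adj, edge_adj]
      grind

/-! ### Minimal Ramsey graphs -/

theorem IsTwoForest.of_copy {V W : Type*} {G : SimpleGraph V} {H : SimpleGraph W}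
    (f : Copy H G) (hG : IsTwoForest G) : IsTwoForest H := by
  obtain ⟨F₁, F₂, h₁, h₂, h⟩ := hG
  exact ⟨F₁.comap f.toEmbedding, F₂.comap f.toEmbedding, h₁.of_comap _, h₂.of_comap _,
    fun x y hxy => h (f.toHom.map_adj hxy)⟩

theorem IsRamsey.of_copy {V W : Type*} {G : SimpleGraph V} {H : SimpleGraph W}
    (hH : IsRamsey H) (f : Copy H G) : IsRamsey G :=
  isRamsey_iff.2 fun h => isRamsey_iff.1 hH (h.of_copy f)

/-- A Ramsey graph contained in a minimal Ramsey graph is the whole graph. -/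
theorem IsMinimalRamsey.toSubgraph_eq_top {V W : Type*} {G : SimpleGraph V} {H : SimpleGraph W}
    (hG : IsMinimalRamsey G) (hH : IsRamsey H) (f : Copy H G) : f.toSubgraph = ⊤ := by
  by_contra h
  exact hG.2 _ h (hH.of_copy f.isoToSubgraph.toCopy)

theorem IsMinimalRamsey.nonempty_iso {V W : Type*} {G : SimpleGraph V} {H : SimpleGraph W}
    (hG : IsMinimalRamsey G) (hH : IsRamsey H) (f : Copy H G) : Nonempty (G ≃g H) := by
  have h := f.isoToSubgraph
  rw [hG.toSubgraph_eq_top hH f] at h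
  exact ⟨(Subgraph.topIso.symm.trans h.symm)⟩

theorem IsMinimalRamsey.of_iso {V W : Type*} {G : SimpleGraph V} {H : SimpleGraph W}
    (hG : IsMinimalRamsey G) (e : G ≃g H) : IsMinimalRamsey H := by
  refine ⟨hG.1.of_copy e.toCopy, fun K hK hR => ?_⟩
  refine hG.2 (K.map e.symm.toHom) (fun h => hK ?_)
    (hR.of_copy (e.symm.toCopy.isoSubgraphMap K).toCopy)
  have h' : (K.map e.symm.toHom).map e.toHom = ⊤ := by rw [h, Subgraph.map_iso_top]
  rw [← Subgraph.map_comp] at h'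
  have : e.toHom.comp e.symm.toHom = Hom.id := by
    ext x; exact e.apply_symm_apply x
  rwa [this, Subgraph.map_id] at h'

theorem IsMinimalRamsey.isTwoForest_of_lt {V : Type*} {G H : SimpleGraph V}
    (hG : IsMinimalRamsey G) (hH : H < G) : IsTwoForest H := by
  by_contra h
  have := hG.toSubgraph_eq_top (isRamsey_iff.2 h) (Copy.ofLE H G hH.le)
  refine hH.not_ge fun x y hxy => ?_
  have h' : ((Copy.ofLE H G hH.le).toSubgraph).Adj x y := by rw [this]; exact hxy
  simpa using h'

/-- Deleting an isolated vertex gives a proper subgraph, and two forests covering that also cover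
`G`. -/
theorem IsMinimalRamsey.exists_adj {V : Type*} {G : SimpleGraph V}
    (hG : IsMinimalRamsey G) (v : V) : ∃ w, G.Adj v w := by
  classical
  by_contra! hv
  have h := hG.2 ((⊤ : G.Subgraph).deleteVerts {v}) fun h => by
    have : v ∈ ((⊤ : G.Subgraph).deleteVerts {v}).verts := by rw [h]; trivial
    simp at this
  rw [isRamsey_iff, not_not] at h
  obtain ⟨F₁, F₂, h₁, h₂, hF⟩ := h
  refine isRamsey_iff.1 hG.1 ⟨F₁.map (Function.Embedding.subtype _),
    F₂.map (Function.Embedding.subtype _), isAcyclic_map h₁ _, isAcyclic_map h₂ _, ?_⟩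
  intro x y hxy
  have hx : x ≠ v := by rintro rfl; exact hv _ hxy
  have hy : y ≠ v := by rintro rfl; exact hv _ hxy.symm
  have hx' : x ∈ ((⊤ : G.Subgraph).deleteVerts {v}).verts := by simp [hx]
  have hy' : y ∈ ((⊤ : G.Subgraph).deleteVerts {v}).verts := by simp [hy]
  have hxy' : (((⊤ : G.Subgraph).deleteVerts {v}).coe).Adj ⟨x, hx'⟩ ⟨y, hy'⟩ := by
    simp [hx, hy, hxy]
  rcases hF hxy' with h | h
  · exact Or.inl ((map_adj _ _ _ _).2 ⟨_, _, h, rfl, rfl⟩)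
  · exact Or.inr ((map_adj _ _ _ _).2 ⟨_, _, h, rfl, rfl⟩)

theorem IsMinimalRamsey.nonempty {V : Type*} {G : SimpleGraph V} (hG : IsMinimalRamsey G) :
    Nonempty V := by
  obtain ⟨_, v, _⟩ := hG.1 fun _ => 0
  exact ⟨v⟩

theorem IsMinimalRamsey.ncard_edgeSet_lt {V : Type*} [Finite V] {G : SimpleGraph V}
    (hG : IsMinimalRamsey G) : G.edgeSet.ncard < 2 * Nat.card V := by
  have := hG.nonempty
  obtain ⟨v⟩ := hG.nonempty
  obtain ⟨w, hvw⟩ := hG.exists_adj v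
  have h := (hG.isTwoForest_of_lt (H := G.deleteEdges {s(v, w)}) (by
    refine lt_of_le_of_ne (deleteEdges_le _) fun h => ?_
    have := h ▸ hvw
    simp at this)).ncard_edgeSet_add_two_le
  rw [edgeSet_deleteEdges, Set.ncard_sdiff_singleton_of_mem (G.mem_edgeSet.2 hvw)] at h
  omega

/-- A minimal Ramsey graph has no `K₄` attached to the rest of the graph at a single vertex. -/
theorem IsMinimalRamsey.not_pendant {V : Type*} {G : SimpleGraph V} (hG : IsMinimalRamsey G)
    {a b c d : V} (hab : a ≠ b) (hac : a ≠ c) (had : a ≠ d) (hbc : G.Adj b c) (hbd : b ≠ d)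
    (hcd : c ≠ d) (hb : ∀ x, G.Adj b x → x = a ∨ x = c ∨ x = d)
    (hc : ∀ x, G.Adj c x → x = a ∨ x = b ∨ x = d)
    (hd : ∀ x, G.Adj d x → x = a ∨ x = b ∨ x = c) : False := by
  have hbc' := hbc.ne
  let S : Set V := {b, c, d}
  let H : SimpleGraph V :=
    { Adj := fun x y => G.Adj x y ∧ x ∉ S ∧ y ∉ S
      symm := ⟨fun x y h => ⟨h.1.symm, h.2.2, h.2.1⟩⟩
      loopless := ⟨fun x h => h.1.ne rfl⟩ }
  have H_adj : ∀ x y, H.Adj x y ↔ G.Adj x y ∧ (x ≠ b ∧ x ≠ c ∧ x ≠ d) ∧ (y ≠ b ∧ y ≠ c ∧ y ≠ d) := by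
    intro x y
    simp [H, S]
  have hlt : H < G := by
    refine lt_of_le_of_ne (fun x y h => h.1) fun h => ?_
    have := (H_adj _ _).1 (h ▸ hbc)
    simp at this
  obtain ⟨F₁, F₂, h₁, h₂, hF⟩ := hG.isTwoForest_of_lt hlt
  have g₁ : (F₁ ⊓ H).IsAcyclic := h₁.anti inf_le_left
  have g₂ : (F₂ ⊓ H).IsAcyclic := h₂.anti inf_le_left
  -- The six pairs from `a, b, c, d` split into the paths `a b c d` and `c a d b`. In the order
  -- chosen, each new edge ends in a vertex isolated so far.
  have e₁ : (F₁ ⊓ H ⊔ edge a b ⊔ edge b c ⊔ edge c d).IsAcyclic := by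
    refine isAcyclic_sup_edge_of_isolated (isAcyclic_sup_edge_of_isolated
      (isAcyclic_sup_edge_of_isolated g₁ ?_) ?_) ?_
    all_goals
      intro y hy
      simp only [sup_adj, inf_adj, H_adj, edge_adj] at hy
      grind
  have e₂ : (F₂ ⊓ H ⊔ edge a c ⊔ edge a d ⊔ edge d b).IsAcyclic := by
    refine isAcyclic_sup_edge_of_isolated (isAcyclic_sup_edge_of_isolated
      (isAcyclic_sup_edge_of_isolated g₂ ?_) ?_) ?_
    all_goals
      intro y hy
      simp only [sup_adj, inf_adj, H_adj, edge_adj] at hy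
      grind
  refine isRamsey_iff.1 hG.1 ⟨_, _, e₁, e₂, ?_⟩
  intro x y hxy
  have h3 : H.Adj x y → F₁.Adj x y ∨ F₂.Adj x y := fun h => hF h
  have := hxy.ne
  have := hb x; have := hc x; have := hd x
  have := hb y; have := hc y; have := hd y
  have := hxy.symm
  simp only [sup_adj, inf_adj, H_adj, edge_adj] at h3 ⊢
  grind

/-! ### The two base graphs -/

theorem K5e_adj (i j : Fin 5) :
    K5e.Adj i j ↔ i ≠ j ∧ ¬ (i = 3 ∧ j = 4) ∧ ¬ (i = 4 ∧ j = 3) := by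
  simp [K5e]

instance : DecidableRel K5e.Adj := fun _ _ => decidable_of_iff' _ (K5e_adj _ _)

instance : DecidableRel K4vK4.Adj := fun i j => by unfold K4vK4; infer_instance

/-- Two forests on `n` vertices have at most `2n - 2` edges; both base graphs have `2n - 1`. -/
theorem isRamsey_K5e : IsRamsey K5e := by
  rw [isRamsey_iff]
  intro h
  have h1 := h.ncard_edgeSet_add_two_le
  rw [← coe_edgeFinset, Set.ncard_coe_finset, Nat.card_eq_fintype_card, Fintype.card_fin,
    show K5e.edgeFinset.card = 9 by decide] at h1
  omega

theorem isRamsey_K4vK4 : IsRamsey K4vK4 := by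
  rw [isRamsey_iff]
  intro h
  have h1 := h.ncard_edgeSet_add_two_le
  rw [← coe_edgeFinset, Set.ncard_coe_finset, Nat.card_eq_fintype_card, Fintype.card_fin,
    show K4vK4.edgeFinset.card = 11 by decide] at h1
  omega

/-- The union of the cliques contains `K4vK4` if they share two vertices and `K5e` if they share
three; by minimality this copy is all of `G`. -/
theorem IsMinimalRamsey.isBase_of_inter {V : Type*} [DecidableEq V] {G : SimpleGraph V}
    (hG : IsMinimalRamsey G) {s t : Finset V} (hs : G.IsNClique 4 s) (ht : G.IsNClique 4 t)
    (hst : s ≠ t) (h : 2 ≤ (s ∩ t).card) : IsBase G := by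
  have hs4 := hs.card_eq
  have ht4 := ht.card_eq
  have c1 := Finset.card_sdiff_add_card_inter s t
  have c2 := Finset.card_sdiff_add_card_inter t s
  rw [Finset.inter_comm t s] at c2
  have hpos : 0 < (s \ t).card := by
    rw [Finset.card_pos, Finset.sdiff_nonempty]
    intro hsub
    exact hst (Finset.eq_of_subset_of_card_le hsub (by omega))
  have hcs : ∀ x ∈ s, ∀ y ∈ s, x ≠ y → G.Adj x y := fun x hx y hy => hs.isClique hx hy
  have hct : ∀ x ∈ t, ∀ y ∈ t, x ≠ y → G.Adj x y := fun x hx y hy => ht.isClique hx hy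
  rcases (show (s ∩ t).card = 2 ∨ (s ∩ t).card = 3 by omega) with h2 | h3
  · right
    obtain ⟨p, q, hpq, hst'⟩ := Finset.card_eq_two.1 h2
    obtain ⟨x, y, hxy, hs'⟩ := Finset.card_eq_two.1 (show (s \ t).card = 2 by omega)
    obtain ⟨z, w, hzw, ht'⟩ := Finset.card_eq_two.1 (show (t \ s).card = 2 by omega)
    have m : ∀ a, (a ∈ s ↔ a = p ∨ a = q ∨ a = x ∨ a = y) ∧
        (a ∈ t ↔ a = p ∨ a = q ∨ a = z ∨ a = w) := by
      intro a
      have a1 := congrArg (a ∈ ·) hst'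
      have a2 := congrArg (a ∈ ·) hs'
      have a3 := congrArg (a ∈ ·) ht'
      simp only [Finset.mem_inter, Finset.mem_sdiff, Finset.mem_insert,
        Finset.mem_singleton, eq_iff_iff] at a1 a2 a3
      grind
    have n : ∀ a, ¬ ((a = x ∨ a = y) ∧ a ∈ t) ∧ ¬ ((a = z ∨ a = w) ∧ a ∈ s) := by
      intro a
      have a2 := congrArg (a ∈ ·) hs'
      have a3 := congrArg (a ∈ ·) ht'
      simp only [Finset.mem_sdiff, Finset.mem_insert,
        Finset.mem_singleton, eq_iff_iff] at a2 a3
      grind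
    have inj : Function.Injective ![p, q, x, y, z, w] := by
      intro i j hij
      fin_cases i <;> fin_cases j <;> simp at hij ⊢ <;> grind
    refine hG.nonempty_iso isRamsey_K4vK4 ⟨⟨![p, q, x, y, z, w], ?_⟩, inj⟩
    rintro i j ⟨hij, h | h⟩
    · refine hcs _ ?_ _ ?_ (inj.ne hij)
      · obtain ⟨h, -⟩ := h
        rw [(m _).1]
        fin_cases i <;> simp at h ⊢
      · obtain ⟨-, h⟩ := h
        rw [(m _).1]
        fin_cases j <;> simp at h ⊢
    · refine hct _ ?_ _ ?_ (inj.ne hij)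
      · obtain ⟨h, -⟩ := h
        rw [(m _).2]
        fin_cases i <;> simp at h ⊢
      · obtain ⟨-, h⟩ := h
        rw [(m _).2]
        fin_cases j <;> simp at h ⊢
  · left
    obtain ⟨p, q, r, hpq, hpr, hqr, hst'⟩ := Finset.card_eq_three.1 h3
    obtain ⟨x, hs'⟩ := Finset.card_eq_one.1 (show (s \ t).card = 1 by omega)
    obtain ⟨y, ht'⟩ := Finset.card_eq_one.1 (show (t \ s).card = 1 by omega)
    have m : ∀ a, (a ∈ s ↔ a = p ∨ a = q ∨ a = r ∨ a = x) ∧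
        (a ∈ t ↔ a = p ∨ a = q ∨ a = r ∨ a = y) := by
      intro a
      have a1 := congrArg (a ∈ ·) hst'
      have a2 := congrArg (a ∈ ·) hs'
      have a3 := congrArg (a ∈ ·) ht'
      simp only [Finset.mem_inter, Finset.mem_sdiff, Finset.mem_insert,
        Finset.mem_singleton, eq_iff_iff] at a1 a2 a3
      grind
    have n : x ∉ t ∧ y ∉ s := by
      have a2 := congrArg (x ∈ ·) hs'
      have a3 := congrArg (y ∈ ·) ht'
      simp only [Finset.mem_sdiff, Finset.mem_singleton, eq_iff_iff] at a2 a3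
      grind
    have inj : Function.Injective ![p, q, r, x, y] := by
      intro i j hij
      fin_cases i <;> fin_cases j <;> simp at hij ⊢ <;> grind
    refine hG.nonempty_iso isRamsey_K5e ⟨⟨![p, q, r, x, y], ?_⟩, inj⟩
    intro i j hij
    rw [K5e_adj] at hij
    have hne := inj.ne hij.1
    by_cases hi : i = 4 ∨ j = 4
    · refine hct _ ?_ _ ?_ hne
      all_goals
        rw [(m _).2]
        fin_cases i <;> fin_cases j <;> simp at hij hi ⊢
    · refine hcs _ ?_ _ ?_ hne
      all_goals
        rw [(m _).1]
        fin_cases i <;> fin_cases j <;> simp at hij hi ⊢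

/-! ### Discharging when every edge is in two triangles -/

section Discharging

variable {V : Type*} [Fintype V] [DecidableEq V] {G : SimpleGraph V} [DecidableRel G.Adj]

theorem three_le_degree (hT : ∀ u v, G.Adj u v → 2 ≤ (G.neighborFinset u ∩ G.neighborFinset v).card)
    (hN : ∀ v, ∃ w, G.Adj v w) (v : V) : 3 ≤ G.degree v := by
  obtain ⟨w, hw⟩ := hN v
  have h : insert w (G.neighborFinset v ∩ G.neighborFinset w) ⊆ G.neighborFinset v := by
    intro x
    simp only [Finset.mem_insert, Finset.mem_inter, mem_neighborFinset]
    rintro (rfl | h)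
    exacts [hw, h.1]
  have h' := Finset.card_le_card h
  rw [Finset.card_insert_of_notMem (by simp), card_neighborFinset_eq_degree] at h'
  have := hT v w hw
  omega

/-- For a neighbour `a` of `v`, the two common neighbours required by `hT` must be the other two
neighbours of `v`. -/
theorem isNClique_of_degree_eq_three
    (hT : ∀ u v, G.Adj u v → 2 ≤ (G.neighborFinset u ∩ G.neighborFinset v).card) {v : V}
    (hv : G.degree v = 3) : G.IsNClique 4 (insert v (G.neighborFinset v)) := by
  have h : G.IsNClique 3 (G.neighborFinset v) := by
    refine ⟨fun a ha b hb hab => ?_, hv⟩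
    have ha' : a ∈ G.neighborFinset v := ha
    have hsub : G.neighborFinset v ∩ G.neighborFinset a ⊆ (G.neighborFinset v).erase a := by
      intro x hx
      simp only [Finset.mem_inter, mem_neighborFinset, Finset.mem_erase] at hx ⊢
      exact ⟨hx.2.ne', hx.1⟩
    have heq := Finset.eq_of_subset_of_card_le hsub (by
      rw [Finset.card_erase_of_mem ha', card_neighborFinset_eq_degree, hv]
      exact hT v a (by simpa using ha'))
    have hb' : b ∈ (G.neighborFinset v).erase a := Finset.mem_erase.2 ⟨hab.symm, hb⟩
    rw [← heq] at hb'
    simpa using (Finset.mem_inter.1 hb').2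
  exact h.insert fun b hb => by simpa using hb

/-- If `a` had degree `4`, it would have one neighbour `x` outside the `K₄` around `v`. The edge
`ax` needs two common neighbours, and `v` is none, so `x` is joined to all of `N(v)`. This gives a
second `K₄` sharing a triangle with the first. -/
theorem degree_ne_four
    (hT : ∀ u v, G.Adj u v → 2 ≤ (G.neighborFinset u ∩ G.neighborFinset v).card)
    (hQ : ∀ s t, G.IsNClique 4 s → G.IsNClique 4 t → 2 ≤ (s ∩ t).card → s = t) {v a : V}
    (hv : G.degree v = 3) (hva : G.Adj v a) : G.degree a ≠ 4 := by
  intro ha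
  have hc := isNClique_of_degree_eq_three hT hv
  have hav : ∀ x, G.Adj v x → x ≠ a → G.Adj a x := fun x hx hxa =>
    hc.isClique (by simp [hva]) (by simp [hx]) hxa.symm
  have hsub : (insert v (G.neighborFinset v)).erase a ⊆ G.neighborFinset a := by
    intro x hx
    simp only [Finset.mem_erase, Finset.mem_insert, mem_neighborFinset] at hx ⊢
    obtain ⟨hxa, rfl | hx⟩ := hx
    · exact hva.symm
    · exact hav x hx hxa
  have hcard : ((insert v (G.neighborFinset v)).erase a).card = 3 := by
    rw [Finset.card_erase_of_mem (by simp [hva]), hc.card_eq]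
  obtain ⟨x, hx⟩ := Finset.card_eq_one.1 (show
    (G.neighborFinset a \ (insert v (G.neighborFinset v)).erase a).card = 1 by
      rw [Finset.card_sdiff_of_subset hsub, card_neighborFinset_eq_degree, ha, hcard])
  have hx' : x ∈ G.neighborFinset a \ (insert v (G.neighborFinset v)).erase a := by simp [hx]
  have hmem : ∀ y, G.Adj a y → y = x ∨ y = v ∨ G.Adj v y := by
    intro y hy
    by_contra! hn
    have : y ∈ G.neighborFinset a \ (insert v (G.neighborFinset v)).erase a := by
      simp [hy, hn.2.1, hn.2.2]
    rw [hx, Finset.mem_singleton] at this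
    exact hn.1 this
  have hax : G.Adj a x := by simpa using (Finset.mem_sdiff.1 hx').1
  have hxv : x ≠ v ∧ ¬ G.Adj v x := by
    have := (Finset.mem_sdiff.1 hx').2
    simpa [hax.ne'] using this
  have hsub' : G.neighborFinset a ∩ G.neighborFinset x ⊆ (G.neighborFinset v).erase a := by
    intro y hy
    simp only [Finset.mem_inter, mem_neighborFinset, Finset.mem_erase] at hy ⊢
    refine ⟨hy.1.ne', ?_⟩
    rcases hmem y hy.1 with rfl | rfl | h
    · exact (hy.2.ne rfl).elim
    · exact (hxv.2 hy.2.symm).elim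
    · exact h
  have heq := Finset.eq_of_subset_of_card_le hsub' (by
    rw [Finset.card_erase_of_mem (by simpa using hva), card_neighborFinset_eq_degree, hv]
    exact hT a x hax)
  have hclq : G.IsNClique 3 (G.neighborFinset v) := by
    refine ⟨hc.isClique.subset ?_, hv⟩
    simp
  have hxclq : G.IsNClique 4 (insert x (G.neighborFinset v)) := by
    refine hclq.insert fun b hb => ?_
    by_cases hba : b = a
    · rw [hba]; exact hax.symm
    · have : b ∈ (G.neighborFinset v).erase a := Finset.mem_erase.2 ⟨hba, hb⟩
      rw [← heq] at this
      simpa using (Finset.mem_inter.1 this).2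
  have := hQ _ _ hc hxclq (by
    have h1 : G.neighborFinset v ⊆ insert v (G.neighborFinset v) ∩ insert x (G.neighborFinset v) :=
      Finset.subset_inter (Finset.subset_insert _ _) (Finset.subset_insert _ _)
    have h2 := Finset.card_le_card h1
    rw [card_neighborFinset_eq_degree, hv] at h2
    omega)
  have hx'' : x ∈ insert v (G.neighborFinset v) := by rw [this]; simp
  simp [hxv] at hx''

theorem closedNeighborhood_eq
    (hT : ∀ u v, G.Adj u v → 2 ≤ (G.neighborFinset u ∩ G.neighborFinset v).card)
    (hQ : ∀ s t, G.IsNClique 4 s → G.IsNClique 4 t → 2 ≤ (s ∩ t).card → s = t) {v w x y : V}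
    (hv : G.degree v = 3) (hw : G.degree w = 3) (hxy : x ≠ y)
    (hx : x ∈ insert v (G.neighborFinset v) ∩ insert w (G.neighborFinset w))
    (hy : y ∈ insert v (G.neighborFinset v) ∩ insert w (G.neighborFinset w)) :
    insert v (G.neighborFinset v) = insert w (G.neighborFinset w) :=
  hQ _ _ (isNClique_of_degree_eq_three hT hv) (isNClique_of_degree_eq_three hT hw)
    (Finset.one_lt_card.2 ⟨x, hx, y, hy, hxy⟩)

/-- With two such neighbours, the `K₄` around `v` would meet the rest of the graph in its fourth
vertex only, against `IsMinimalRamsey.not_pendant`. -/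
theorem card_filter_degree_eq_three_le_one (hG : IsMinimalRamsey G)
    (hT : ∀ u v, G.Adj u v → 2 ≤ (G.neighborFinset u ∩ G.neighborFinset v).card)
    (hQ : ∀ s t, G.IsNClique 4 s → G.IsNClique 4 t → 2 ≤ (s ∩ t).card → s = t) {v : V}
    (hv : G.degree v = 3) : ((G.neighborFinset v).filter (G.degree · = 3)).card ≤ 1 := by
  by_contra! h
  obtain ⟨b, hb, c, hc, hbc⟩ := Finset.one_lt_card.1 h
  simp only [Finset.mem_filter, mem_neighborFinset] at hb hc
  have hQb := closedNeighborhood_eq hT hQ hv hb.2 hb.1.ne (by simp [hb.1.symm]) (by simp [hb.1])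
  have hQc := closedNeighborhood_eq hT hQ hv hc.2 hc.1.ne (by simp [hc.1.symm]) (by simp [hc.1])
  have hsub : ({b, c} : Finset V) ⊆ G.neighborFinset v := by
    intro x hx
    simp only [Finset.mem_insert, Finset.mem_singleton, mem_neighborFinset] at hx ⊢
    rcases hx with rfl | rfl
    exacts [hb.1, hc.1]
  obtain ⟨a, ha⟩ := Finset.card_eq_one.1 (show (G.neighborFinset v \ {b, c}).card = 1 by
    rw [Finset.card_sdiff_of_subset hsub, card_neighborFinset_eq_degree, hv,
      Finset.card_pair hbc])
  have hmem : ∀ x, G.Adj v x ↔ x = a ∨ x = b ∨ x = c := by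
    intro x
    have h1 := congrArg (x ∈ ·) ha
    have h2 := @hsub x
    simp only [Finset.mem_insert, Finset.mem_singleton, Finset.mem_sdiff, mem_neighborFinset,
      eq_iff_iff] at h1 h2
    grind
  have ha' : a ∈ G.neighborFinset v \ {b, c} := by simp [ha]
  simp only [Finset.mem_insert, Finset.mem_singleton, Finset.mem_sdiff, mem_neighborFinset,
    not_or] at ha'
  refine hG.not_pendant ha'.1.ne' ha'.2.1 ha'.2.2 hb.1 hc.1.ne hbc (fun x hx => (hmem x).1 hx)
    (fun x hx => ?_) (fun x hx => ?_)
  · have : x ∈ insert b (G.neighborFinset b) := by simp [hx]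
    rw [← hQb, Finset.mem_insert, mem_neighborFinset, hmem] at this
    have := hx.ne'
    tauto
  · have : x ∈ insert c (G.neighborFinset c) := by simp [hx]
    rw [← hQc, Finset.mem_insert, mem_neighborFinset, hmem] at this
    have := hx.ne'
    tauto

theorem two_le_card_filter_five_le_degree (hG : IsMinimalRamsey G)
    (hT : ∀ u v, G.Adj u v → 2 ≤ (G.neighborFinset u ∩ G.neighborFinset v).card)
    (hQ : ∀ s t, G.IsNClique 4 s → G.IsNClique 4 t → 2 ≤ (s ∩ t).card → s = t) {v : V}
    (hv : G.degree v = 3) : 2 ≤ ((G.neighborFinset v).filter (5 ≤ G.degree ·)).card := by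
  have h1 := card_filter_degree_eq_three_le_one hG hT hQ hv
  have h2 := (G.neighborFinset v).card_filter_add_card_filter_not (G.degree · = 3)
  rw [card_neighborFinset_eq_degree, hv] at h2
  have h3 : (G.neighborFinset v).filter (fun a => ¬ G.degree a = 3) =
      (G.neighborFinset v).filter (5 ≤ G.degree ·) := by
    refine Finset.filter_congr fun a ha => ?_
    have h4 := degree_ne_four hT hQ hv ((mem_neighborFinset _ _ _).1 ha)
    have h5 := three_le_degree hT hG.exists_adj a
    omega
  rw [← h3]
  omega

/-- Each neighbour of `u` of degree `3` spans a `K₄` through `u`. Distinct ones meet only in `u`, so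
there are at most `⌊d/3⌋` of them for `d = G.degree u`, each with at most two vertices of degree
`3`. -/
theorem card_filter_degree_eq_three_le (hG : IsMinimalRamsey G)
    (hT : ∀ u v, G.Adj u v → 2 ≤ (G.neighborFinset u ∩ G.neighborFinset v).card)
    (hQ : ∀ s t, G.IsNClique 4 s → G.IsNClique 4 t → 2 ≤ (s ∩ t).card → s = t) {u : V}
    (hu : 5 ≤ G.degree u) :
    ((G.neighborFinset u).filter (G.degree · = 3)).card + 8 ≤ 2 * G.degree u := by
  set D := (G.neighborFinset u).filter (G.degree · = 3) with hD
  have hmemD : ∀ v, v ∈ D ↔ G.Adj u v ∧ G.degree v = 3 := fun v => by simp [hD]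
  let f : V → Finset V := fun v => (insert v (G.neighborFinset v)).erase u
  have huQ : ∀ v ∈ D, u ∈ insert v (G.neighborFinset v) := fun v hv => by
    simp [((hmemD v).1 hv).1.symm]
  have hinsert : ∀ v ∈ D, insert u (f v) = insert v (G.neighborFinset v) := fun v hv =>
    Finset.insert_erase (huQ v hv)
  have hfib : D.card ≤ 2 * (D.image f).card := by
    refine Finset.card_le_mul_card_image D 2 fun s hs => ?_
    obtain ⟨v, hv, rfl⟩ := Finset.mem_image.1 hs
    have hsub : D.filter (fun w => f w = f v) ⊆
        insert v ((G.neighborFinset v).filter (G.degree · = 3)) := by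
      intro w hw
      obtain ⟨hw, hwv⟩ := Finset.mem_filter.1 hw
      have h1 : w ∈ insert v (G.neighborFinset v) := by
        rw [← hinsert v hv, ← hwv, hinsert w hw]; simp
      rw [Finset.mem_insert] at h1 ⊢
      exact h1.imp_right fun h => Finset.mem_filter.2 ⟨h, ((hmemD w).1 hw).2⟩
    refine (Finset.card_le_card hsub).trans ((Finset.card_insert_le _ _).trans ?_)
    have := card_filter_degree_eq_three_le_one hG hT hQ ((hmemD v).1 hv).2
    omega
  have hdisj : 3 * (D.image f).card ≤ G.degree u := by
    have hpd : ((D.image f : Finset (Finset V)) : Set (Finset V)).PairwiseDisjoint id := by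
      intro s hs t ht hst
      obtain ⟨v, hv, rfl⟩ := Finset.mem_image.1 hs
      obtain ⟨w, hw, rfl⟩ := Finset.mem_image.1 ht
      rw [Function.onFun, Finset.disjoint_left]
      intro x hx hx'
      simp only [id, f, Finset.mem_erase] at hx hx'
      refine hst (congrArg (Finset.erase · u) ?_)
      exact closedNeighborhood_eq hT hQ ((hmemD v).1 hv).2 ((hmemD w).1 hw).2 hx.1
        (Finset.mem_inter.2 ⟨hx.2, hx'.2⟩) (Finset.mem_inter.2 ⟨huQ v hv, huQ w hw⟩)
    have hcard := Finset.card_biUnion hpd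
    have h3 : ∀ s ∈ D.image f, (id s).card = 3 := by
      intro s hs
      obtain ⟨v, hv, rfl⟩ := Finset.mem_image.1 hs
      rw [id, Finset.card_erase_of_mem (huQ v hv),
        (isNClique_of_degree_eq_three hT ((hmemD v).1 hv).2).card_eq]
    rw [Finset.sum_congr rfl h3, Finset.sum_const, smul_eq_mul] at hcard
    rw [mul_comm, ← hcard, ← card_neighborFinset_eq_degree]
    refine Finset.card_le_card (Finset.biUnion_subset.2 fun s hs x hx => ?_)
    obtain ⟨v, hv, rfl⟩ := Finset.mem_image.1 hs
    obtain ⟨hxu, hx⟩ := Finset.mem_erase.1 hx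
    rw [mem_neighborFinset]
    exact (isNClique_of_degree_eq_three hT ((hmemD v).1 hv).2).isClique (huQ v hv) hx hxu.symm
  -- `2⌊d/3⌋ + 8 ≤ 2d` for `d ≥ 5`, with equality at `5` and `6`; the rounding is needed at `5`.
  omega

/-- Give each vertex the charge `deg - 4`, and let every vertex of degree at least `5` send `1/2` to
each neighbour of degree `3`. No final charge is negative; `key` is this statement doubled. -/
theorem four_mul_card_le_sum_degree (hG : IsMinimalRamsey G)
    (hT : ∀ u v, G.Adj u v → 2 ≤ (G.neighborFinset u ∩ G.neighborFinset v).card)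
    (hQ : ∀ s t, G.IsNClique 4 s → G.IsNClique 4 t → 2 ≤ (s ∩ t).card → s = t) :
    4 * Fintype.card V ≤ ∑ v, G.degree v := by
  let r : V → V → Prop := fun u v => G.Adj u v ∧ 5 ≤ G.degree u ∧ G.degree v = 3
  have hdc : ∑ u, (Finset.univ.filter fun v => r u v).card =
      ∑ v, (Finset.univ.filter fun u => r u v).card :=
    Finset.sum_card_bipartiteAbove_eq_sum_card_bipartiteBelow r
  have key : ∀ v, 8 + (Finset.univ.filter fun w => r v w).card ≤
      2 * G.degree v + (Finset.univ.filter fun w => r w v).card := by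
    intro v
    rcases (show G.degree v = 3 ∨ G.degree v = 4 ∨ 5 ≤ G.degree v by
      have := three_le_degree hT hG.exists_adj v
      omega) with h | h | h
    · have h1 : (Finset.univ.filter fun w => r v w).card = 0 := by simp [r, h]
      have h2 : (Finset.univ.filter fun w => r w v) =
          (G.neighborFinset v).filter (5 ≤ G.degree ·) := by
        ext w; simp [r, h, G.adj_comm]
      have := two_le_card_filter_five_le_degree hG hT hQ h
      rw [h1, h2]
      omega
    · have h1 : (Finset.univ.filter fun w => r v w).card = 0 := by simp [r, h]
      omega
    · have h2 : (Finset.univ.filter fun w => r v w) =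
          (G.neighborFinset v).filter (G.degree · = 3) := by
        ext w; simp [r, h]
      have := card_filter_degree_eq_three_le hG hT hQ h
      rw [h2]
      omega
  have hsum := Finset.sum_le_sum fun v (_ : v ∈ Finset.univ) => key v
  rw [Finset.sum_add_distrib, Finset.sum_add_distrib, hdc, ← Finset.mul_sum, Finset.sum_const,
    Finset.card_univ, smul_eq_mul] at hsum
  omega

end Discharging

/-! ### Edges and their triangles -/

/-- The ends of an edge in two triangles have two common neighbours. -/
theorem two_le_card_of_not_isContractible {V : Type*} [Fintype V] [DecidableEq V]
    {G : SimpleGraph V} [DecidableRel G.Adj] {u v : V} (huv : G.Adj u v)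
    (h : ¬ IsContractible G s(u, v)) :
    2 ≤ (G.neighborFinset u ∩ G.neighborFinset v).card := by
  rw [IsContractible, not_and, not_le, Set.one_lt_encard_iff] at h
  obtain ⟨s, t, ⟨hs, hs'⟩, ⟨ht, ht'⟩, hst⟩ := h huv
  have third : ∀ s : Finset V, s ∈ G.cliqueSet 3 → (∀ x ∈ s(u, v), x ∈ s) →
      ∃ x, G.Adj u x ∧ G.Adj v x ∧ s = {u, v, x} := by
    intro s hs hs'
    have hs : G.IsNClique 3 s := hs
    have hu : u ∈ s := hs' u (by simp)
    have hv : v ∈ s := hs' v (by simp)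
    obtain ⟨x, hx⟩ := Finset.card_eq_one.1 (show (s \ {u, v}).card = 1 by
      rw [Finset.card_sdiff_of_subset (by grind), hs.card_eq, Finset.card_pair huv.ne])
    have hx' : x ∈ s \ {u, v} := by simp [hx]
    simp only [Finset.mem_sdiff, Finset.mem_insert, Finset.mem_singleton, not_or] at hx'
    refine ⟨x, hs.isClique hu hx'.1 (Ne.symm hx'.2.1), hs.isClique hv hx'.1 (Ne.symm hx'.2.2), ?_⟩
    ext y
    have := congrArg (y ∈ ·) hx
    simp only [Finset.mem_sdiff, Finset.mem_insert, Finset.mem_singleton, eq_iff_iff] at this ⊢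
    grind
  obtain ⟨x, hux, hvx, rfl⟩ := third s hs hs'
  obtain ⟨y, huy, hvy, rfl⟩ := third t ht ht'
  refine Finset.one_lt_card.2 ⟨x, by simp [hux, hvx], y, by simp [huy, hvy], ?_⟩
  rintro rfl
  exact hst rfl

theorem eq_of_isContractible {V : Type*} {G : SimpleGraph V} {u v : V}
    (h : IsContractible G s(u, v)) {x y : V} (hxu : G.Adj x u) (hxv : G.Adj x v)
    (hyu : G.Adj y u) (hyv : G.Adj y v) : x = y := by
  classical
  have huv : G.Adj u v := h.1
  have key := Set.encard_le_one_iff.1 h.2 {u, v, x} {u, v, y}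
    ⟨is3Clique_triple_iff.2 ⟨huv, hxu.symm, hxv.symm⟩, by simp⟩
    ⟨is3Clique_triple_iff.2 ⟨huv, hyu.symm, hyv.symm⟩, by simp⟩
  have hx : x ∈ ({u, v, y} : Finset V) := by rw [← key]; simp
  simpa [hxu.ne, hxv.ne] using hx

/-- A minimal Ramsey graph each of whose edges is in two triangles is one of the base graphs. -/
theorem IsMinimalRamsey.isBase {V : Type*} [Finite V] {G : SimpleGraph V}
    (hG : IsMinimalRamsey G) (h : ∀ e, ¬ IsContractible G e) : IsBase G := by
  classical
  have := Fintype.ofFinite V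
  by_contra hb
  have hT : ∀ u v, G.Adj u v → 2 ≤ (G.neighborFinset u ∩ G.neighborFinset v).card :=
    fun u v huv => two_le_card_of_not_isContractible huv (h _)
  have hQ : ∀ s t, G.IsNClique 4 s → G.IsNClique 4 t → 2 ≤ (s ∩ t).card → s = t := by
    intro s t hs ht hst
    by_contra hne
    exact hb (hG.isBase_of_inter hs ht hne hst)
  have h1 := four_mul_card_le_sum_degree hG hT hQ
  have h2 := hG.ncard_edgeSet_lt
  rw [← coe_edgeFinset, Set.ncard_coe_finset, Nat.card_eq_fintype_card] at h2
  rw [sum_degrees_eq_twice_card_edges] at h1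
  omega

/-! ### Contracting an edge -/

theorem contract_mk_eq {V : Type*} {u v x y : V}
    (h : Quotient.mk (contractSetoid s(u, v)) x = Quotient.mk (contractSetoid s(u, v)) y) :
    x = y ∨ (x = u ∧ y = v) ∨ (x = v ∧ y = u) := by
  rcases Quotient.exact h with h | ⟨h₁, h₂⟩
  · exact Or.inl h
  · rw [Sym2.mem_iff] at h₁ h₂
    grind

theorem IsRamsey.contract {V : Type*} {G : SimpleGraph V} (hG : IsRamsey G) {e : Sym2 V}
    (he : IsContractible G e) : IsRamsey (contract G e) := by
  induction e using Sym2.inductionOn with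
  | hf u v =>
    rw [isRamsey_iff] at hG ⊢
    refine fun h => hG (isTwoForest_of_identify he.1 ?_ (fun x y => contract_mk_eq)
      (fun x y => eq_of_isContractible he) h)
    exact Quotient.sound (Or.inr ⟨by simp, by simp⟩)

/-- Take an inclusion-minimal Ramsey subgraph `K`; a Ramsey subgraph of `K.coe` is also one of `G`,
so it is all of `K`. -/
theorem IsRamsey.exists_isMinimalRamsey {V : Type*} [Finite V] {G : SimpleGraph V}
    (hG : IsRamsey G) : ∃ K : G.Subgraph, IsMinimalRamsey K.coe := by
  have hne : {K : G.Subgraph | IsRamsey K.coe}.Nonempty :=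
    ⟨⊤, hG.of_copy Subgraph.topIso.symm.toCopy⟩
  obtain ⟨K, hK⟩ := (Set.toFinite {K : G.Subgraph | IsRamsey K.coe}).exists_minimal hne
  refine ⟨K, hK.1, fun L hL hR => hL ?_⟩
  have h : IsRamsey (Subgraph.coeSubgraph L).coe :=
    hR.of_copy (K.coeCopy.isoSubgraphMap L).toCopy
  have h' := le_antisymm (Subgraph.coeSubgraph_le L) (hK.2 h (Subgraph.coeSubgraph_le L))
  refine Subgraph.coeSubgraph_injective K (h'.trans ?_)
  exact (Subgraph.map_hom_top K).symm

theorem card_verts_lt {V : Type*} [Finite V] {G : SimpleGraph V} {e : Sym2 V}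
    (he : e ∈ G.edgeSet) (K : (contract G e).Subgraph) : Nat.card K.verts < Nat.card V := by
  have h₁ : Nat.card K.verts ≤ Nat.card (Quotient (contractSetoid e)) :=
    Nat.card_le_card_of_injective _ Subtype.val_injective
  refine h₁.trans_lt ?_
  induction e using Sym2.inductionOn with
  | hf u v =>
    refine lt_of_le_of_ne (Nat.card_le_card_of_surjective _ Quotient.mk_surjective) fun h => ?_
    have hb := (Nat.bijective_iff_surjective_and_card
      (Quotient.mk (contractSetoid s(u, v)))).2 ⟨Quotient.mk_surjective, h.symm⟩
    exact he.ne (hb.1 (Quotient.sound (Or.inr ⟨by simp, by simp⟩)))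

/-- The branch sets are the fibres of the quotient map: single vertices or the two ends of `e`. -/
theorem isMinor_of_contract {V : Type*} {G : SimpleGraph V} {e : Sym2 V}
    (he : e ∈ G.edgeSet) (K : (contract G e).Subgraph) : IsMinor K.coe G := by
  refine ⟨fun w => {x | Quotient.mk (contractSetoid e) x = w.1}, fun w => ?_, fun v w hvw => ?_,
    fun v w hvw => ?_⟩
  · rw [connected_iff]
    constructor
    · rintro ⟨x, hx⟩ ⟨y, hy⟩
      have hxy : Quotient.mk (contractSetoid e) x = Quotient.mk (contractSetoid e) y :=
        Eq.trans hx (Eq.symm hy)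
      induction e using Sym2.inductionOn with
      | hf u v =>
        rcases contract_mk_eq hxy with rfl | ⟨rfl, rfl⟩ | ⟨rfl, rfl⟩
        · exact Reachable.refl _
        · exact Adj.reachable (show G.Adj x y from he)
        · exact Adj.reachable (show G.Adj x y from (G.mem_edgeSet.1 he).symm)
    · obtain ⟨x, hx⟩ := Quotient.exists_rep w.1
      exact ⟨⟨x, hx⟩⟩
  · rw [Set.disjoint_left]
    intro x hx hx'
    exact hvw (Subtype.ext (Eq.trans (Eq.symm hx) hx'))
  · obtain ⟨-, x, y, hxy, hx, hy⟩ := K.adj_sub hvw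
    exact ⟨x, hx, y, hy, hxy⟩

theorem isProperMinor_of_contract {V : Type*} [Finite V] {G : SimpleGraph V} {e : Sym2 V}
    (he : e ∈ G.edgeSet) (K : (contract G e).Subgraph) : IsProperMinor K.coe G :=
  ⟨isMinor_of_contract he K, ⟨fun f => (card_verts_lt he K).ne (Nat.card_congr f.toEquiv)⟩⟩

/-! ### Reduction steps and chains -/

theorem IsMinor.of_iso {U V W : Type*} {H : SimpleGraph U} {G : SimpleGraph V}
    {K : SimpleGraph W} (f : H ≃g K) (h : IsMinor K G) : IsMinor H G := by
  obtain ⟨B, h₁, h₂, h₃⟩ := h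
  exact ⟨fun v => B (f v), fun v => h₁ _, fun v w hvw => h₂ _ _ (f.injective.ne hvw),
    fun v w hvw => h₃ _ _ (f.map_adj_iff.2 hvw)⟩

theorem IsReduction.isProperMinor {H G : FinGraph.{u}} (h : IsReduction H G) :
    IsProperMinor H.graph G.graph := by
  have := G.fin
  obtain ⟨e, he, K, hK, ⟨f⟩⟩ := h
  have hp := isProperMinor_of_contract he.1 K
  exact ⟨hp.1.of_iso f, ⟨fun g => hp.2.false (f.symm.trans g)⟩⟩

theorem IsReduction.isMinimalRamsey {H G : FinGraph.{u}} (h : IsReduction H G) :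
    IsMinimalRamsey H.graph := by
  obtain ⟨e, he, K, hK, ⟨f⟩⟩ := h
  exact hK.of_iso f.symm

theorem IsReduction.card_lt {H G : FinGraph.{u}} (h : IsReduction H G) :
    Nat.card H.V < Nat.card G.V := by
  have := G.fin
  obtain ⟨e, he, K, hK, ⟨f⟩⟩ := h
  rw [Nat.card_congr f.toEquiv]
  exact card_verts_lt he.1 K

theorem exists_isReduction {G : FinGraph.{u}} (hG : IsMinimalRamsey G.graph)
    (hb : ¬ IsBase G.graph) : ∃ H : FinGraph.{u}, IsReduction H G := by
  have := G.fin
  obtain ⟨e, he⟩ : ∃ e, IsContractible G.graph e := by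
    by_contra! h
    exact hb (hG.isBase h)
  have : Finite (Quotient (contractSetoid e)) := Quotient.finite _
  obtain ⟨K, hK⟩ := (hG.1.contract he).exists_isMinimalRamsey
  exact ⟨⟨K.verts, K.coe⟩, e, he, K, hK, ⟨Iso.refl⟩⟩

theorem exists_reductions_to_isBase (G : FinGraph.{u}) (hG : IsMinimalRamsey G.graph) :
    ∃ (n : ℕ) (S : ℕ → FinGraph.{u}), IsBase (S 0).graph ∧ S n = G ∧
      ∀ k < n, IsReduction (S k) (S (k + 1)) := by
  induction hc : Nat.card G.V using Nat.strong_induction_on generalizing G with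
  | _ c ih =>
    by_cases hb : IsBase G.graph
    · exact ⟨0, fun _ => G, hb, rfl, by simp⟩
    · obtain ⟨H, hH⟩ := exists_isReduction hG hb
      obtain ⟨n, S, h₀, hn, hS⟩ := ih _ (hc ▸ hH.card_lt) H hH.isMinimalRamsey rfl
      refine ⟨n + 1, fun k => if k ≤ n then S k else G, by simpa using h₀, by simp, ?_⟩
      intro k hk
      rcases Nat.lt_succ_iff_lt_or_eq.1 hk with h | rfl
      · simpa [h.le, Nat.succ_le_of_lt h] using hS k h
      · simpa [hn] using hH

theorem exists_chain_of_reductions (G : FinGraph.{u}) (hG : IsMinimalRamsey G.graph) (m : ℕ)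
    (T : ℕ → FinGraph.{u}) (hT₀ : T 0 = G) (hT : ∀ i < m, IsReduction (T (i + 1)) (T i)) :
    ∃ (n : ℕ) (S : ℕ → FinGraph.{u}), m ≤ n ∧ (∀ i ≤ m, S (n - i) = T i) ∧
      IsMinorChain n S G ∧ ∀ k < n, IsReduction (S k) (S (k + 1)) := by
  have hTm : IsMinimalRamsey (T m).graph := by
    cases m with
    | zero => rwa [hT₀]
    | succ m => exact (hT m (Nat.lt_succ_self m)).isMinimalRamsey
  obtain ⟨n, S, h₀, hn, hS⟩ := exists_reductions_to_isBase (T m) hTm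
  -- `S` leads up from a base graph to `S n = T m`, and `T` read backwards continues from there to
  -- `G`.
  let R : ℕ → FinGraph.{u} := fun k => if k ≤ n then S k else T (n + m - k)
  have hR : ∀ k < n + m, IsReduction (R k) (R (k + 1)) := by
    intro k hk
    by_cases h : k < n
    · simpa [R, h.le, Nat.succ_le_of_lt h] using hS k h
    · have h₁ : R (k + 1) = T (n + m - (k + 1)) := by simp [R, h]
      have h₂ : R k = T (n + m - k) := by
        by_cases h' : k = n
        · subst h'
          simp [R, hn]
        · have : ¬ k ≤ n := by omega
          simp [R, this]
      have h₃ := hT (n + m - (k + 1)) (by omega)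
      rw [h₁, h₂]
      rwa [show n + m - (k + 1) + 1 = n + m - k by omega] at h₃
  have hRT : ∀ i ≤ m, R (n + m - i) = T i := by
    intro i hi
    by_cases h : i = m
    · subst h
      simp [R, hn]
    · have h₁ : ¬ n + m - i ≤ n := by omega
      have h₂ : n + m - (n + m - i) = i := by omega
      simp [R, h₁, h₂]
  have hRG : R (n + m) = G := by
    have := hRT 0 (Nat.zero_le m)
    rwa [Nat.sub_zero, hT₀] at this
  refine ⟨n + m, R, by omega, hRT, ⟨by simpa [R] using h₀, hRG, fun k hk => ?_,
    fun k hk => (hR k hk).isProperMinor⟩, hR⟩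
  rcases hk.lt_or_eq with h | rfl
  · exact (hR k h).isMinimalRamsey
  · rwa [hRG]

end CyclicRamsey

theorem theorem1p3 (G : CyclicRamsey.FinGraph.{u}) (hG : CyclicRamsey.IsMinimalRamsey G.graph) :
    -- a chain of minors from a base graph to `G` exists
    (∃ (n : ℕ) (S : ℕ → CyclicRamsey.FinGraph.{u}), CyclicRamsey.IsMinorChain n S G) ∧
    -- every choice of edge is admissible, and then so is every choice of minimal Ramsey subgraph
    (∀ e : Sym2 G.V, CyclicRamsey.IsContractible G.graph e →
      CyclicRamsey.IsRamsey (CyclicRamsey.contract G.graph e) ∧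
      (∃ K : (CyclicRamsey.contract G.graph e).Subgraph, CyclicRamsey.IsMinimalRamsey K.coe) ∧
      ∀ K : (CyclicRamsey.contract G.graph e).Subgraph, CyclicRamsey.IsMinimalRamsey K.coe →
        CyclicRamsey.IsProperMinor K.coe G.graph) ∧
    -- reduction steps made from `G` with arbitrary choices can always be completed to such a chain
    (∀ (m : ℕ) (T : ℕ → CyclicRamsey.FinGraph.{u}), T 0 = G →
      (∀ i < m, CyclicRamsey.IsReduction (T (i + 1)) (T i)) →
      ∃ (n : ℕ) (S : ℕ → CyclicRamsey.FinGraph.{u}), m ≤ n ∧ (∀ i ≤ m, S (n - i) = T i) ∧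
        CyclicRamsey.IsMinorChain n S G ∧ ∀ k < n, CyclicRamsey.IsReduction (S k) (S (k + 1))) ∧
    -- and the steps cannot go on for ever
    ¬ ∃ T : ℕ → CyclicRamsey.FinGraph.{u}, T 0 = G ∧
      ∀ i, CyclicRamsey.IsReduction (T (i + 1)) (T i) := by
  have := G.fin
  refine ⟨?_, fun e he => ⟨hG.1.contract he, ?_, fun K _ =>
    CyclicRamsey.isProperMinor_of_contract he.1 K⟩,
    CyclicRamsey.exists_chain_of_reductions G hG, ?_⟩
  · obtain ⟨n, S, -, -, h, -⟩ :=
      CyclicRamsey.exists_chain_of_reductions G hG 0 (fun _ => G) rfl (by simp)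
    exact ⟨n, S, h⟩
  · have : Finite (Quotient (CyclicRamsey.contractSetoid e)) := Quotient.finite _
    exact (hG.1.contract he).exists_isMinimalRamsey
  · rintro ⟨T, -, hT⟩
    -- Each step lowers the number of vertices.
    obtain ⟨i, hi⟩ := WellFounded.not_rel_apply_succ (r := (· < ·)) fun i => Nat.card (T i).V
    exact hi (hT i).card_lt
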